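/- For $m\ge 2$ let $N_m(x)=\int_0^1 N_{m-1}(x-t)\,dt$, where $N_1=\chi_{[0,1)}$, and let $$L^4(x)=\sum_{n\in\mathbb Z}(-1)^n\sqrt3\,(2-\sqrt3)^{|n|}\,N_4(x+2-n).$$ For $n\in\mathbb Z$ put $$a_n=\begin{cases}(-6-4\sqrt3)(-2-\sqrt3)^{n-1}+\left(6+\tfrac{7\sqrt3}{2}\right)(7+4\sqrt3)^{n-1}, & n\le 1,\\ (6-4\sqrt3)(-2+\sqrt3)^{n-1}+\left(-6+\tfrac{7\sqrt3}{2}\right)(7-4\sqrt3)^{n-1}, & n>1,\end{cases}$$ and let $$v(t)=\frac1{36}\begin{cases}t^3, & 0\le t\le 1/2,\\ 1-6t+12t^2-7t^3, & 1/2<t\le 1,\\ -22+63t-57t^2+16t^3, & 1<t\le 3/2,\\ 86-153t+87t^2-16t^3, & 3/2<t\le 2,\\ -98+123t-51t^2+7t^3, & 2<t\le 5/2,\\ 27-27t+9t^2-t^3, & 5/2<t\le 3,\\ 0, & \text{otherwise.}\end{cases}$$ For $j\in\mathbb N_0=\{0,1,2,\dots\}$ and $k\in\mathbb Z$ define the cubic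 Faber splines $$s_{j,k}(x)=\sum_{n\in\mathbb Z}a_n\,v(2^jx-k-n),$$ and, with $\Delta_h^4f(x)=\sum_{l=0}^4(-1)^{4-l}\binom4l f(x+hl)$, the coefficients $$\lambda_{j,k}(f)=\frac16\left(\Delta^4_{2^{-j-1}}f\left(\tfrac{2k}{2^{j+1}}\right)-4\,\Delta^4_{2^{-j-1}}f\left(\tfrac{2k+1}{2^{j+1}}\right)+\Delta^4_{2^{-j-1}}f\left(\tfrac{2k+2}{2^{j+1}}\right)\right).$$ For a compactly supported function $f$ on $\mathbb R$ and $N\in\mathbb N_0$ let $$S_Nf(x)=\sum_{k\in\mathbb Z}f(k)\,L^4(x-k)+\sum_{j=0}^{N-1}\sum_{k\in\mathbb Z}\lambda_{j,k}(f)\,s_{j,k}(x)$$ (for each $x$ all these sums have only finitely many nonzero terms). **Theorem.** For every compactly supported continuous (real- or complex-valued) function $f$ on $\mathbb R$, the functions $S_Nf$ converge to $f$ uniformly on $\mathbb R$, i.e. $$\lim_{N\to\infty}\|f-S_Nf\|_\infty=0.$$ -/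

import Mathlib

open Filter Topology MeasureTheory

noncomputable section

namespace FaberSpline

/-- The cardinal B-spline `N_m` of order `m ≥ 1` with knots at the integers: `N_1 = χ_[0,1)` and
`N_m(x) = ∫_0^1 N_{m-1}(x - t) dt`. (The value at order `0` is a placeholder, never used.) -/
def bspline : ℕ → ℝ → ℝ
  | 0 => fun _ => 0
  | 1 => Set.indicator (Set.Ico (0 : ℝ) 1) (fun _ => 1)
  | m + 2 => fun x => ∫ t in (0 : ℝ)..1, bspline (m + 1) (x - t)

/-- The fundamental cubic cardinal spline
`L^4(x) = ∑_{n ∈ ℤ} (-1)^n √3 (2 - √3)^|n| N_4(x + 2 - n)`.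
For each `x` only finitely many terms are nonzero, since `N_4` vanishes outside `[0,4]`. -/
def L4 (x : ℝ) : ℝ :=
  ∑' n : ℤ, (-1 : ℝ) ^ n * √3 * (2 - √3) ^ n.natAbs * bspline 4 (x + 2 - n)

/-- The coefficients `a_n` of the dual linear Chui-Wang wavelet, `ψ_2^* = ∑ a_n ψ_2(· - n)`. -/
def dualCoeff (n : ℤ) : ℝ :=
  if n ≤ 1 then
    (-6 - 4 * √3) * (-2 - √3) ^ (n - 1) + (6 + 7 * √3 / 2) * (7 + 4 * √3) ^ (n - 1)
  else
    (6 - 4 * √3) * (-2 + √3) ^ (n - 1) + (-6 + 7 * √3 / 2) * (7 - 4 * √3) ^ (n - 1)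

/-- The compactly supported piecewise cubic function `v`, given by its pieces on `[0,3]`. -/
def v (t : ℝ) : ℝ :=
  1 / 36 *
    if t < 0 then 0
    else if t ≤ 1 / 2 then t ^ 3
    else if t ≤ 1 then 1 - 6 * t + 12 * t ^ 2 - 7 * t ^ 3
    else if t ≤ 3 / 2 then -22 + 63 * t - 57 * t ^ 2 + 16 * t ^ 3
    else if t ≤ 2 then 86 - 153 * t + 87 * t ^ 2 - 16 * t ^ 3
    else if t ≤ 5 / 2 then -98 + 123 * t - 51 * t ^ 2 + 7 * t ^ 3
    else if t ≤ 3 then 27 - 27 * t + 9 * t ^ 2 - t ^ 3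
    else 0

/-- The cubic Faber splines `s_{j,k}(x) = ∑_{n ∈ ℤ} a_n v(2^j x - k - n)`, `j ≥ 0`, `k ∈ ℤ`.
For each `x` only finitely many terms are nonzero, since `v` vanishes outside `[0,3]`. -/
def s (j : ℕ) (k : ℤ) (x : ℝ) : ℝ :=
  ∑' n : ℤ, dualCoeff n * v (2 ^ j * x - k - n)

variable {𝕜 : Type*} [RCLike 𝕜]

/-- The difference `Δ_h^m f(x) = ∑_{l=0}^m (-1)^{m-l} (m choose l) f(x + h l)`. -/
def diff (m : ℕ) (h : ℝ) (f : ℝ → 𝕜) (x : ℝ) : 𝕜 :=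
  ∑ l ∈ Finset.range (m + 1), ((-1 : ℝ) ^ (m - l) * (m.choose l : ℝ)) • f (x + h * l)

/-- The coefficients `λ_{j,k}(f)`: `1/6` times the combination, with weights `1, -4, 1`, of the
fourth differences of `f` with step `2^{-j-1}` at the points `(2k + l) / 2^{j+1}`, `l = 0, 1, 2`. -/
def coeff (j : ℕ) (k : ℤ) (f : ℝ → 𝕜) : 𝕜 :=
  (1 / 6 : ℝ) •
    (diff 4 (1 / 2 ^ (j + 1)) f (2 * k / 2 ^ (j + 1))
      - (4 : ℝ) • diff 4 (1 / 2 ^ (j + 1)) f ((2 * k + 1) / 2 ^ (j + 1))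
      + diff 4 (1 / 2 ^ (j + 1)) f ((2 * k + 2) / 2 ^ (j + 1)))

/-- The partial sum operator of the Faber spline expansion,
`S_N f(x) = ∑_k f(k) L^4(x - k) + ∑_{j=0}^{N-1} ∑_k λ_{j,k}(f) s_{j,k}(x)`.
For compactly supported `f`, only finitely many `f(k)` and, for each `j`, only finitely many
`λ_{j,k}(f)` are nonzero, so all sums over `k ∈ ℤ` are finite. -/
def S (N : ℕ) (f : ℝ → 𝕜) (x : ℝ) : 𝕜 :=
  (∑' k : ℤ, L4 (x - k) • f k)
    + ∑ j ∈ Finset.range N, ∑' k : ℤ, s j k x • coeff j k f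

end FaberSpline

end

noncomputable section

namespace FaberSpline

/-! The partial sums telescope: `S_eq_interpolant` shows that `S N f x` is the cardinal spline
series `∑ L4 (2^N x - k) f(k/2^N)`. The induction step is a two-scale relation, in which `L4 (2x)`
and `L4 (2x - 1)` are expressed through `L4 x` and integer shifts of `mother` (`L4_two_mul`,
`L4_two_mul_sub_one`). Written in the B-splines `N_4(2x - n)`, both sides have explicit
coefficients, so the relation reduces to identities between the geometric sequence `cardCoeff` and
`dualCoeff`, which follow from the recurrence `cardCoeff_rec`.

For convergence, regroup the series as `∑ N_4(2^N x + 2 - m) b_m`, where `b` is the convolution of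
the samples with `cardCoeff` (`hasSum_interpolant`). Since `cardCoeff` is absolutely summable with
sum `1`, `b_m` is uniformly close to `f(m/2^N)`. Since the shifts of `N_4` are nonnegative, locally
supported and sum to `1`, averaging these values stays close to `f x` by uniform continuity. That
`L4` interpolates at the integers is never needed. -/

/-! ### B-splines through truncated powers. -/

lemma hasDerivAt_max_zero_pow (p : ℕ) {x : ℝ} (hx : x ≠ 0) :
    HasDerivAt (fun y : ℝ => max y 0 ^ (p + 1)) ((p + 1) * (if 0 ≤ x then x ^ p else 0)) x := by
  rcases lt_or_gt_of_ne hx with h | h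
  · rw [if_neg (not_le.mpr h), mul_zero]
    refine (hasDerivAt_const x (0 : ℝ)).congr_of_eventuallyEq ?_
    filter_upwards [Iio_mem_nhds h] with y hy
    simp [max_eq_right (le_of_lt (Set.mem_Iio.mp hy))]
  · rw [if_pos h.le]
    have := hasDerivAt_pow (p + 1) x
    simp only [Nat.cast_add, Nat.cast_one, Nat.add_sub_cancel] at this
    refine this.congr_of_eventuallyEq ?_
    filter_upwards [Ioi_mem_nhds h] with y hy
    simp [max_eq_left (le_of_lt (Set.mem_Ioi.mp hy))]

lemma integral_max_zero_pow (p : ℕ) (x : ℝ) :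
    ∫ t in (0 : ℝ)..1, max (x - t) 0 ^ (p + 1)
      = (max x 0 ^ (p + 2) - max (x - 1) 0 ^ (p + 2)) / (p + 2) := by
  rw [intervalIntegral.integral_comp_sub_left (fun y => max y 0 ^ (p + 1)) x]
  have hp : (p : ℝ) + 2 ≠ 0 := by positivity
  rw [integral_eq_of_hasDerivAt_off_countable (fun y : ℝ => max y 0 ^ (p + 2) / (p + 2))
    (fun y => max y 0 ^ (p + 1)) (Set.countable_singleton (0 : ℝ))]
  · rw [sub_zero, sub_div]
  · fun_prop
  · intro y hy
    have h := (hasDerivAt_max_zero_pow (p + 1) (x := y) (by simpa using hy.2)).div_const ((p : ℝ) + 2)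
    refine h.congr_deriv ?_
    push_cast
    split_ifs with h0
    · rw [max_eq_left h0]; field_simp; ring
    · rw [max_eq_right (not_le.mp h0).le]; simp
  · exact Continuous.intervalIntegrable (by fun_prop) _ _

lemma bspline_two (x : ℝ) : bspline 2 x = max x 0 - 2 * max (x - 1) 0 + max (x - 2) 0 := by
  have h1 : bspline 2 x = ∫ t in (0 : ℝ)..1, bspline 1 (x - t) := rfl
  rw [h1, intervalIntegral.integral_comp_sub_left (bspline 1) x,
    integral_eq_of_hasDerivAt_off_countable (fun y : ℝ => max y 0 - max (y - 1) 0)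
    (bspline 1) (Set.toFinite ({0, 1} : Set ℝ)).countable]
  · rw [sub_zero, sub_sub x 1 1, one_add_one_eq_two]; ring
  · fun_prop
  · intro y hy
    have hy2 := hy.2
    simp only [Set.mem_insert_iff, Set.mem_singleton_iff, not_or] at hy2
    have ha := hasDerivAt_max_zero_pow 0 hy2.1
    have hb := (hasDerivAt_max_zero_pow 0 (sub_ne_zero.mpr hy2.2)).comp_sub_const y 1
    have h := ha.sub hb
    simp only [zero_add, pow_one, Nat.cast_zero, one_mul, pow_zero] at h
    refine h.congr_deriv ?_
    simp only [bspline, Set.indicator, Set.mem_Ico]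
    have h0 := lt_or_gt_of_ne hy2.1
    have h1 := lt_or_gt_of_ne hy2.2
    grind
  · refine IntegrableOn.intervalIntegrable ?_
    exact (integrable_indicator_iff measurableSet_Ico).mpr (by simp) |>.integrableOn

lemma bspline_three (x : ℝ) : bspline 3 x = (max x 0 ^ 2 - 3 * max (x - 1) 0 ^ 2
    + 3 * max (x - 2) 0 ^ 2 - max (x - 3) 0 ^ 2) / 2 := by
  have h1 : bspline 3 x = ∫ t in (0 : ℝ)..1, bspline 2 (x - t) := rfl
  have h2 : ∀ t, bspline 2 (x - t) = max (x - t) 0 ^ (0 + 1) - 2 * max (x - 1 - t) 0 ^ (0 + 1)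
      + max (x - 2 - t) 0 ^ (0 + 1) := by
    intro t; rw [bspline_two]; ring_nf
  simp_rw [h1, h2]
  rw [intervalIntegral.integral_add, intervalIntegral.integral_sub,
    intervalIntegral.integral_const_mul]
  · simp only [integral_max_zero_pow]; ring_nf
  all_goals exact Continuous.intervalIntegrable (by fun_prop) _ _

lemma bspline_four (x : ℝ) : bspline 4 x = (max x 0 ^ 3 - 4 * max (x - 1) 0 ^ 3
    + 6 * max (x - 2) 0 ^ 3 - 4 * max (x - 3) 0 ^ 3 + max (x - 4) 0 ^ 3) / 6 := by
  have h1 : bspline 4 x = ∫ t in (0 : ℝ)..1, bspline 3 (x - t) := rfl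
  have h2 : ∀ t, bspline 3 (x - t) = (max (x - t) 0 ^ (1 + 1) - 3 * max (x - 1 - t) 0 ^ (1 + 1)
      + 3 * max (x - 2 - t) 0 ^ (1 + 1) - max (x - 3 - t) 0 ^ (1 + 1)) / 2 := by
    intro t; rw [bspline_three]; ring_nf
  simp_rw [h1, h2]
  rw [intervalIntegral.integral_div, intervalIntegral.integral_sub, intervalIntegral.integral_add,
    intervalIntegral.integral_sub, intervalIntegral.integral_const_mul,
    intervalIntegral.integral_const_mul]
  · simp only [integral_max_zero_pow]; push_cast; ring_nf
  all_goals exact Continuous.intervalIntegrable (by fun_prop) _ _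

lemma bspline_nonneg (m : ℕ) (x : ℝ) : 0 ≤ bspline m x := by
  induction m generalizing x with
  | zero => simp [bspline]
  | succ m ih =>
    cases m with
    | zero => exact Set.indicator_nonneg (fun _ _ => zero_le_one) x
    | succ m => exact intervalIntegral.integral_nonneg zero_le_one (fun t _ => ih (x - t))

lemma bspline_four_eq_zero {x : ℝ} (hx : x ≤ 0 ∨ 4 ≤ x) : bspline 4 x = 0 := by
  rw [bspline_four]
  rcases hx with h | h
  · rw [max_eq_right h, max_eq_right (by linarith), max_eq_right (by linarith),
      max_eq_right (by linarith), max_eq_right (by linarith)]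
    norm_num
  · rw [max_eq_left (by linarith), max_eq_left (by linarith), max_eq_left (by linarith),
      max_eq_left (by linarith), max_eq_left (by linarith)]
    ring

/-- Truncated cubes are homogeneous of degree 3, and the weights reflect `(1 + z)^4 (1 - z)^4 = (1 -
z^2)^4`. -/
lemma bspline_four_refinement (x : ℝ) : bspline 4 x = (bspline 4 (2 * x)
    + 4 * bspline 4 (2 * x - 1) + 6 * bspline 4 (2 * x - 2) + 4 * bspline 4 (2 * x - 3)
    + bspline 4 (2 * x - 4)) / 8 := by
  have key : ∀ y : ℝ, max (2 * y) 0 ^ 3 = 8 * max y 0 ^ 3 := by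
    intro y
    have : max (2 * y) 0 = 2 * max y 0 := by rw [mul_max_of_nonneg _ _ zero_le_two, mul_zero]
    rw [this]; ring
  have h0 := key x
  have h1 := key (x - 1)
  have h2 := key (x - 2)
  have h3 := key (x - 3)
  have h4 := key (x - 4)
  simp only [bspline_four, mul_sub, sub_sub] at *
  norm_num at *
  linarith

lemma v_eq (t : ℝ) : v t = (bspline 4 (2 * t) - 4 * bspline 4 (2 * t - 1)
    + bspline 4 (2 * t - 2)) / 48 := by
  simp only [bspline_four, v, sub_sub]
  norm_num only
  split_ifs with h0 h1 h2 h3 h4 h5 h6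
  all_goals
    -- On each piece every truncated power has a known sign, so a polynomial identity remains.
    simp (disch := grind) only [max_eq_left, max_eq_right]
    ring

lemma tsum_bspline_four (x : ℝ) : ∑' n : ℤ, bspline 4 (x - n) = 1 := by
  have hl := Int.floor_le x
  have hu := Int.lt_floor_add_one x
  rw [tsum_eq_sum (s := Finset.Icc (⌊x⌋ - 3) ⌊x⌋)]
  · have : Finset.Icc (⌊x⌋ - 3) ⌊x⌋ = {⌊x⌋ - 3, ⌊x⌋ - 2, ⌊x⌋ - 1, ⌊x⌋} := by
      ext k; simp only [Finset.mem_Icc, Finset.mem_insert, Finset.mem_singleton]; omega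
    rw [this, Finset.sum_insert (by simp), Finset.sum_insert (by simp),
      Finset.sum_insert (by simp), Finset.sum_singleton]
    push_cast
    generalize (⌊x⌋ : ℝ) = k at hl hu
    simp (disch := grind) only [bspline_four, max_eq_left, max_eq_right]
    ring
  · intro k hk
    apply bspline_four_eq_zero
    rw [Finset.mem_Icc, not_and_or, not_le, not_le] at hk
    rcases hk with h | h
    · right
      have : (k : ℝ) + 1 ≤ ⌊x⌋ - 3 := by exact_mod_cast h
      linarith
    · left
      have : (⌊x⌋ : ℝ) + 1 ≤ k := by exact_mod_cast h
      linarith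

/-! ### Coefficient sequences and their recurrences. -/

/-- The coefficients `√3 (√3 - 2)^|n|` of `L4` in the B-spline basis. -/
def cardCoeff (n : ℤ) : ℝ := √3 * (√3 - 2) ^ n.natAbs

lemma sqrt_three_sq : √3 ^ 2 = 3 := Real.sq_sqrt (by norm_num)

lemma root_sq : (√3 - 2) ^ 2 = -4 * (√3 - 2) - 1 := by
  linear_combination sqrt_three_sq

lemma root_inv : (-2 - √3) = (√3 - 2)⁻¹ := by
  refine eq_inv_of_mul_eq_one_left ?_
  linear_combination -sqrt_three_sq

lemma cardCoeff_neg (n : ℤ) : cardCoeff (-n) = cardCoeff n := by simp [cardCoeff]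

lemma cardCoeff_natCast (n : ℕ) : cardCoeff n = √3 * (√3 - 2) ^ n := by simp [cardCoeff]

/-- The indicator of `0` in `ℤ`. -/
def delta (n : ℤ) : ℝ := if n = 0 then 1 else 0

lemma delta_neg (n : ℤ) : delta (-n) = delta n := by simp [delta]

/-- The ratio `√3 - 2` is a root of `z^2 + 4z + 1`, which settles `j ≠ 0`; the factor `√3`
normalizes the value at `j = 0`. -/
lemma cardCoeff_rec (j : ℤ) :
    cardCoeff (j - 1) + 4 * cardCoeff j + cardCoeff (j + 1) = 6 * delta j := by
  have pos : ∀ j : ℕ, cardCoeff (j - 1) + 4 * cardCoeff j + cardCoeff (j + 1) = 6 * delta j := by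
    intro j
    cases j with
    | zero =>
      simp [cardCoeff, delta]
      linear_combination 2 * sqrt_three_sq
    | succ k =>
      have h : ((k + 1 : ℕ) : ℤ) - 1 = (k : ℕ) := by push_cast; ring
      have h' : ((k + 1 : ℕ) : ℤ) + 1 = (k + 2 : ℕ) := by push_cast; ring
      rw [h, h', cardCoeff_natCast, cardCoeff_natCast, cardCoeff_natCast, delta,
        if_neg (by positivity)]
      linear_combination √3 * (√3 - 2) ^ k * root_sq
  obtain ⟨k, rfl | rfl⟩ := j.eq_nat_or_neg
  · exact pos k
  · have := pos k
    rw [delta_neg, cardCoeff_neg, ← cardCoeff_neg (-(k : ℤ) - 1), ← cardCoeff_neg (-(k : ℤ) + 1)]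
    rw [show -(-(k : ℤ) - 1) = k + 1 by ring, show -(-(k : ℤ) + 1) = k - 1 by ring]
    linarith

lemma cardCoeff_rec_odd (n : ℤ) :
    cardCoeff (2 * n) + 4 * cardCoeff (2 * n + 1) + cardCoeff (2 * n + 2) = 0 := by
  have h := cardCoeff_rec (2 * n + 1)
  rw [delta, if_neg (by omega), add_sub_cancel_right, add_assoc (2 * n), one_add_one_eq_two] at h
  linarith

/-- Eliminating the odd-indexed terms from three consecutive instances of the recurrence; `14` is
`z^2 + z^{-2}` for `z = √3 - 2`. -/
lemma cardCoeff_rec_even (n : ℤ) :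
    cardCoeff (2 * n - 2) - 14 * cardCoeff (2 * n) + cardCoeff (2 * n + 2) = -24 * delta n := by
  have h := cardCoeff_rec (2 * n)
  have h1 := cardCoeff_rec_odd n
  have h2 := cardCoeff_rec_odd (n - 1)
  have hd : delta (2 * n) = delta n := by simp [delta]
  rw [hd] at h
  rw [show 2 * (n - 1) + 1 = 2 * n - 1 by ring, show 2 * (n - 1) + 2 = 2 * n by ring,
    show 2 * (n - 1) = 2 * n - 2 by ring] at h2
  linarith

/-- The two geometric ratios in `dualCoeff` are `z` and `z^2` for `z = √3 - 2`, or their inverses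
when `n ≤ 1`. This form reduces all later identities to the recurrences of `cardCoeff`. -/
lemma dualCoeff_eq (n : ℤ) : dualCoeff n = 2 * cardCoeff n + cardCoeff (2 * n) / 2 := by
  have h7 : 7 + 4 * √3 = ((√3 - 2) ^ 2)⁻¹ := by
    rw [← inv_pow, ← root_inv]; linear_combination -sqrt_three_sq
  have h7' : 7 - 4 * √3 = (√3 - 2) ^ 2 := by linear_combination -sqrt_three_sq
  have h3 := sqrt_three_sq
  rw [dualCoeff]
  split_ifs with h
  -- The first branch of `dualCoeff` includes `n = 1`, where `|n| ≠ -n`, so that value is checked by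
  -- hand.
  · obtain rfl | h0 := h.eq_or_lt
    · norm_num [cardCoeff]
      linear_combination (-√3 / 2) * sqrt_three_sq
    · obtain ⟨k, rfl⟩ : ∃ k : ℕ, n = -k := ⟨n.natAbs, by omega⟩
      rw [show 2 * (-(k : ℤ)) = -((2 * k : ℕ) : ℤ) by push_cast; ring, cardCoeff_neg, cardCoeff_neg,
        cardCoeff_natCast, cardCoeff_natCast, root_inv, h7, inv_zpow', inv_zpow',
        show -(-(k : ℤ) - 1) = (k + 1 : ℕ) by push_cast; ring, zpow_natCast, zpow_natCast, ← pow_mul,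
        show 2 * (k + 1) = 2 * k + 2 by ring, pow_add _ (2 * k), h7'.symm]
      linear_combination (-4 * (√3 - 2) ^ k - 14 * (√3 - 2) ^ (2 * k)) * h3
  · obtain ⟨k, rfl⟩ : ∃ k : ℕ, n = (k + 1 : ℕ) := ⟨(n - 1).natAbs, by omega⟩
    rw [show 2 * ((k + 1 : ℕ) : ℤ) = ((2 * k + 2 : ℕ) : ℤ) by push_cast; ring,
      cardCoeff_natCast, cardCoeff_natCast, h7', show ((k + 1 : ℕ) : ℤ) - 1 = (k : ℕ) by simp,
      zpow_natCast, zpow_natCast, ← pow_mul, pow_add _ (2 * k), ← h7', pow_succ,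
      show -2 + √3 = √3 - 2 by ring]
    linear_combination (-2 * (√3 - 2) ^ k + 2 * (√3 - 2) ^ (2 * k)) * h3

/-! ### Two-scale identities for the coefficients, by parity of the index on each side. -/

section TwoScale

variable (n : ℤ)

lemma twoScale_even_even : cardCoeff (2 * n + 2) =
    (cardCoeff (n + 2) + 6 * cardCoeff (n + 1) + cardCoeff n) / 8 + (dualCoeff (n - 1)
      + 24 * dualCoeff n + 46 * dualCoeff (n + 1) + 24 * dualCoeff (n + 2) + dualCoeff (n + 3))
      / 288 := by
  have r0 := cardCoeff_rec n
  have r1 := cardCoeff_rec (n + 1)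
  have r2 := cardCoeff_rec (n + 2)
  have q0 := cardCoeff_rec_even n
  have q1 := cardCoeff_rec_even (n + 1)
  have q2 := cardCoeff_rec_even (n + 2)
  simp only [dualCoeff_eq]
  ring_nf at *
  linarith

lemma twoScale_even_odd : cardCoeff (2 * n + 3) =
    (cardCoeff (n + 2) + cardCoeff (n + 1)) / 2 - (dualCoeff n + 23 * dualCoeff (n + 1)
      + 23 * dualCoeff (n + 2) + dualCoeff (n + 3)) / 72 := by
  have r1 := cardCoeff_rec (n + 1)
  have r2 := cardCoeff_rec (n + 2)
  have q1 := cardCoeff_rec_even (n + 1)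
  have q2 := cardCoeff_rec_even (n + 2)
  have o := cardCoeff_rec_odd (n + 1)
  simp only [dualCoeff_eq]
  ring_nf at *
  linarith

lemma twoScale_odd_even : cardCoeff (2 * n + 1) =
    -(dualCoeff (n - 1) + 5 * dualCoeff n + 5 * dualCoeff (n + 1) + dualCoeff (n + 2)) / 36 := by
  have r0 := cardCoeff_rec n
  have r1 := cardCoeff_rec (n + 1)
  have q0 := cardCoeff_rec_even n
  have q1 := cardCoeff_rec_even (n + 1)
  have o := cardCoeff_rec_odd n
  simp only [dualCoeff_eq]
  ring_nf at *
  linarith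

/-- In `2 c_n + c_{2n}/2` the delta terms of the two recurrences, `12 δ` and `-12 δ`, cancel. -/
lemma twoScale_odd_odd : cardCoeff (2 * n + 2) =
    (dualCoeff n + 4 * dualCoeff (n + 1) + dualCoeff (n + 2)) / 9 := by
  have r1 := cardCoeff_rec (n + 1)
  have q1 := cardCoeff_rec_even (n + 1)
  simp only [dualCoeff_eq]
  ring_nf at *
  linarith

end TwoScale

/-! ### Two-scale relations for the functions `L4` and `mother`. -/

lemma hasSum_int_even_add_odd {E : Type*} [AddCommMonoid E] [TopologicalSpace E] [ContinuousAdd E]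
    {f : ℤ → E} {a b : E} (ha : HasSum (fun n => f (2 * n)) a)
    (hb : HasSum (fun n => f (2 * n + 1)) b) : HasSum f (a + b) := by
  have h2 : Function.Injective (fun n : ℤ => 2 * n) := fun m n h => by simpa using h
  have h2' : Function.Injective (fun n : ℤ => 2 * n + 1) := fun m n h => by simpa using h
  replace ha := h2.hasSum_range_iff.2 ha
  replace hb := h2'.hasSum_range_iff.2 hb
  refine ha.add_isCompl ?_ hb
  have : (Set.range fun n : ℤ => 2 * n) = {n | Even n} := by
    ext; simp [even_iff_exists_two_mul]
  have h' : (Set.range fun n : ℤ => 2 * n + 1) = {n | Odd n} := by ext; simp [Odd]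
  rw [this, h']
  exact Int.isCompl_even_odd

lemma finite_support_bspline_four (x : ℝ) :
    (Function.support fun n : ℤ => bspline 4 (x - n)).Finite := by
  refine (Set.finite_Icc ⌊x - 4⌋ ⌈x⌉).subset fun n hn => ?_
  rw [Function.mem_support] at hn
  by_contra h
  apply hn
  apply bspline_four_eq_zero
  rw [Set.mem_Icc, not_and_or, not_le, not_le] at h
  rcases h with h | h
  · have := Int.lt_floor_iff.mp h
    right; linarith
  · have := Int.ceil_lt_iff.mp h
    left; linarith

lemma summable_mul_bspline_four (p : ℤ → ℝ) (x : ℝ) :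
    Summable fun n : ℤ => p n * bspline 4 (x - n) :=
  summable_of_hasFiniteSupport ((finite_support_bspline_four x).subset
    (Function.support_mul_subset_right _ _))

lemma summable_mul_bspline_four_two (p : ℤ → ℝ) (y : ℝ) :
    Summable fun n : ℤ => p n * bspline 4 (y - 2 * n) := by
  -- Integer division extends `p` from the even indices, so this is a subseries of a finite sum.
  have h := (summable_mul_bspline_four (fun n => p (n / 2)) y).comp_injective
    (i := fun n : ℤ => 2 * n) (fun m n h => by simpa using h)
  refine h.congr fun n => ?_
  simp

/-- The spline `∑ p_n N_4(y - 2n)`, as a linear function of the coefficients `p`. -/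
def evenSpline (y : ℝ) : (ℤ → ℝ) →ₗ[ℝ] ℝ where
  toFun p := ∑' n : ℤ, p n * bspline 4 (y - 2 * n)
  map_add' p q := by
    simp only [Pi.add_apply, add_mul]
    exact (summable_mul_bspline_four_two p y).tsum_add (summable_mul_bspline_four_two q y)
  map_smul' c p := by
    simp only [Pi.smul_apply, smul_eq_mul, mul_assoc, tsum_mul_left, RingHom.id_apply]

lemma hasSum_evenSpline (p : ℤ → ℝ) (y : ℝ) :
    HasSum (fun n : ℤ => p n * bspline 4 (y - 2 * n)) (evenSpline y p) :=
  (summable_mul_bspline_four_two p y).hasSum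

lemma evenSpline_add (p : ℤ → ℝ) (y : ℝ) (i : ℤ) :
    evenSpline (y + 2 * i) p = evenSpline y (fun n => p (n + i)) := by
  refine ((Equiv.addRight i).hasSum_iff.mpr (hasSum_evenSpline p (y + 2 * i))).unique ?_
  convert hasSum_evenSpline (fun n => p (n + i)) y using 2 with n
  simp only [Function.comp, Equiv.coe_addRight, Int.cast_add]
  congr 2; ring

lemma hasSum_L4 (x : ℝ) : HasSum (fun n : ℤ => cardCoeff n * bspline 4 (x + 2 - n)) (L4 x) := by
  have h : L4 x = ∑' n : ℤ, cardCoeff n * bspline 4 (x + 2 - n) := by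
    refine tsum_congr fun n => ?_
    congr 1
    have : (-1 : ℝ) ^ n = (-1) ^ n.natAbs := by
      obtain ⟨k, rfl | rfl⟩ := n.eq_nat_or_neg <;> simp [← inv_pow]
    rw [this, cardCoeff, show √3 - 2 = (-1) * (2 - √3) by ring, mul_pow]
    ring
  rw [h]
  exact (summable_mul_bspline_four cardCoeff (x + 2)).hasSum

lemma hasSum_L4_shift (x : ℝ) (i : ℤ) :
    HasSum (fun n : ℤ => cardCoeff (n + i) * bspline 4 (x + 2 - i - n)) (L4 x) := by
  convert (Equiv.addRight i).hasSum_iff.mpr (hasSum_L4 x) using 2 with n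
  simp only [Function.comp, Equiv.coe_addRight, Int.cast_add]
  congr 2; ring

lemma L4_eq_even_add_odd (y : ℝ) (i : ℤ) : L4 (y + i - 2) =
    evenSpline y (fun n => cardCoeff (2 * n + i))
      + evenSpline (y - 1) (fun n => cardCoeff (2 * n + 1 + i)) := by
  refine (hasSum_L4_shift (y + i - 2) i).unique (hasSum_int_even_add_odd ?_ ?_)
  · convert hasSum_evenSpline (fun n => cardCoeff (2 * n + i)) y using 4 with n
    push_cast; ring
  · convert hasSum_evenSpline (fun n => cardCoeff (2 * n + 1 + i)) (y - 1) using 4 with n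
    push_cast; ring

lemma L4_eq_refined (x : ℝ) : L4 x =
    evenSpline (2 * x) (fun n => (cardCoeff (n + 2) + 6 * cardCoeff (n + 1) + cardCoeff n) / 8)
      + evenSpline (2 * x - 1) (fun n => (cardCoeff (n + 2) + cardCoeff (n + 1)) / 2) := by
  set c : ℤ → ℝ := fun n => cardCoeff (n + 2) with hc
  have e : ∀ y, evenSpline (y - 2) c = evenSpline y (fun n => cardCoeff (n + 1)) := by
    intro y
    have := evenSpline_add c y (-1)
    simp only [hc] at this ⊢
    convert this using 2
    · push_cast; ring_nf
    · funext n; ring_nf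
  have e' : ∀ y, evenSpline (y - 4) c = evenSpline y cardCoeff := by
    intro y
    have := evenSpline_add c y (-2)
    simp only [hc] at this ⊢
    convert this using 2
    · push_cast; ring_nf
    · funext n; ring_nf
  have h := ((((((hasSum_evenSpline c (2 * x)).add ((hasSum_evenSpline c (2 * x - 1)).mul_left 4)).add
    ((hasSum_evenSpline c (2 * x - 2)).mul_left 6)).add
    ((hasSum_evenSpline c (2 * x - 3)).mul_left 4)).add
    (hasSum_evenSpline c (2 * x - 4))).div_const 8)
  have hL : L4 x = _ := (hasSum_L4_shift x 2).unique (h.congr_fun ?_)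
  · rw [hL, e, e', show 2 * x - 3 = 2 * x - 1 - 2 by ring, e]
    have h1 : (fun n => (cardCoeff (n + 2) + 6 * cardCoeff (n + 1) + cardCoeff n) / 8)
      = (1 / 8 : ℝ) • (c + (6 : ℝ) • (fun n => cardCoeff (n + 1)) + cardCoeff) := by
      funext n; simp [hc]; ring
    have h2 : (fun n => (cardCoeff (n + 2) + cardCoeff (n + 1)) / 2)
      = (1 / 2 : ℝ) • (c + (fun n => cardCoeff (n + 1))) := by
      funext n; simp [hc]; ring
    rw [h1, h2]
    simp only [map_add, map_smul, smul_eq_mul]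
    ring
  · intro n
    have hb := bspline_four_refinement (x - n)
    rw [show 2 * (x - n) = 2 * x - 2 * n by ring] at hb
    rw [show x + 2 - ((2 : ℤ) : ℝ) - n = x - n by push_cast; ring, hb]
    simp only [hc, sub_right_comm _ (2 * (n : ℝ))]
    ring

/-- The function `∑ a_n v(x - n)` generating the cubic Faber splines. -/
def mother (x : ℝ) : ℝ := ∑' n : ℤ, dualCoeff n * v (x - n)

lemma s_eq (j : ℕ) (k : ℤ) (x : ℝ) : s j k x = mother (2 ^ j * x - k) := rfl

lemma mother_eq (x : ℝ) : mother x =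
    evenSpline (2 * x) (fun n => (dualCoeff n + dualCoeff (n - 1)) / 48)
      - evenSpline (2 * x - 1) (fun n => dualCoeff n / 12) := by
  have e : evenSpline (2 * x - 2) dualCoeff = evenSpline (2 * x) (fun n => dualCoeff (n - 1)) := by
    have := evenSpline_add dualCoeff (2 * x) (-1)
    convert this using 2
    push_cast; ring_nf
    rfl
  have h := (((hasSum_evenSpline dualCoeff (2 * x)).sub
    ((hasSum_evenSpline dualCoeff (2 * x - 1)).mul_left 4)).add
    (hasSum_evenSpline dualCoeff (2 * x - 2))).div_const 48
  have h1 : (fun n => (dualCoeff n + dualCoeff (n - 1)) / 48)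
      = (1 / 48 : ℝ) • (dualCoeff + (fun n => dualCoeff (n - 1))) := by
    funext n; simp; ring
  have h2 : (fun n => dualCoeff n / 12) = (1 / 12 : ℝ) • dualCoeff := by
    funext n; simp; ring
  have hs : mother x = _ := (HasSum.tsum_eq (h.congr_fun ?_))
  · rw [hs, h1, h2, e]
    simp only [map_add, map_smul, smul_eq_mul]
    ring
  · intro n
    have hb := v_eq (x - n)
    rw [show 2 * (x - n) = 2 * x - 2 * n by ring] at hb
    rw [hb]
    simp only [sub_right_comm _ (2 * (n : ℝ))]
    ring

lemma mother_add (x : ℝ) (i : ℤ) : mother (x + i) =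
    evenSpline (2 * x) (fun n => (dualCoeff (n + i) + dualCoeff (n + i - 1)) / 48)
      - evenSpline (2 * x - 1) (fun n => dualCoeff (n + i) / 12) := by
  rw [mother_eq, mul_add, add_sub_right_comm, evenSpline_add, evenSpline_add]

/-- The weights `1, 23, 23, 1` are the even entries of the filter `(1, -4, 6, -4, 1) * (1, -4, 1)`
behind `coeff`; the odd entries `-8, -32, -8` serve `L4 (2x - 1)`. -/
lemma L4_two_mul (x : ℝ) : L4 (2 * x) =
    L4 x + (mother x + 23 * mother (x + 1) + 23 * mother (x + 2) + mother (x + 3)) / 6 := by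
  have m0 := mother_add x 0
  have m1 := mother_add x 1
  have m2 := mother_add x 2
  have m3 := mother_add x 3
  have h := L4_eq_even_add_odd (2 * x) 2
  push_cast at *
  rw [add_zero] at m0
  rw [add_sub_cancel_right] at h
  rw [h, L4_eq_refined, m0, m1, m2, m3]
  have he : (fun n => cardCoeff (2 * n + 2)) =
    (fun n => (cardCoeff (n + 2) + 6 * cardCoeff (n + 1) + cardCoeff n) / 8) + (1 / 6 : ℝ) •
      ((fun n => (dualCoeff (n + 0) + dualCoeff (n + 0 - 1)) / 48)
      + (23 : ℝ) • (fun n => (dualCoeff (n + 1) + dualCoeff (n + 1 - 1)) / 48)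
      + (23 : ℝ) • (fun n => (dualCoeff (n + 2) + dualCoeff (n + 2 - 1)) / 48)
      + (fun n => (dualCoeff (n + 3) + dualCoeff (n + 3 - 1)) / 48)) := by
    funext n
    simp only [Pi.add_apply, Pi.smul_apply, smul_eq_mul, twoScale_even_even]
    ring_nf
  have ho : (fun n => cardCoeff (2 * n + 1 + 2)) =
    (fun n => (cardCoeff (n + 2) + cardCoeff (n + 1)) / 2) - (1 / 6 : ℝ) •
      ((fun n => dualCoeff (n + 0) / 12) + (23 : ℝ) • (fun n => dualCoeff (n + 1) / 12)
      + (23 : ℝ) • (fun n => dualCoeff (n + 2) / 12) + (fun n => dualCoeff (n + 3) / 12)) := by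
    funext n
    simp only [Pi.add_apply, Pi.sub_apply, Pi.smul_apply, smul_eq_mul, add_assoc (2 * n)]
    norm_num only [twoScale_even_odd]
    ring_nf
  rw [he, ho]
  simp only [map_add, map_sub, map_smul, smul_eq_mul]
  ring

lemma L4_two_mul_sub_one (x : ℝ) : L4 (2 * x - 1) =
    -(8 * mother x + 32 * mother (x + 1) + 8 * mother (x + 2)) / 6 := by
  have m0 := mother_add x 0
  have m1 := mother_add x 1
  have m2 := mother_add x 2
  have h := L4_eq_even_add_odd (2 * x) 1
  push_cast at *
  rw [add_zero] at m0
  rw [show 2 * x + 1 - 2 = 2 * x - 1 by ring] at h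
  rw [h, m0, m1, m2]
  have he : (fun n => cardCoeff (2 * n + 1)) = (-1 / 6 : ℝ) •
      ((8 : ℝ) • (fun n => (dualCoeff (n + 0) + dualCoeff (n + 0 - 1)) / 48)
      + (32 : ℝ) • (fun n => (dualCoeff (n + 1) + dualCoeff (n + 1 - 1)) / 48)
      + (8 : ℝ) • (fun n => (dualCoeff (n + 2) + dualCoeff (n + 2 - 1)) / 48)) := by
    funext n
    simp only [Pi.add_apply, Pi.smul_apply, smul_eq_mul, twoScale_odd_even]
    ring_nf
  have ho : (fun n => cardCoeff (2 * n + 1 + 1)) = (1 / 6 : ℝ) •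
      ((8 : ℝ) • (fun n => dualCoeff (n + 0) / 12) + (32 : ℝ) • (fun n => dualCoeff (n + 1) / 12)
      + (8 : ℝ) • (fun n => dualCoeff (n + 2) / 12)) := by
    funext n
    simp only [Pi.add_apply, Pi.smul_apply, smul_eq_mul, add_assoc (2 * n)]
    norm_num only [twoScale_odd_odd]
    ring_nf
  rw [he, ho]
  simp only [map_add, map_smul, smul_eq_mul]
  ring

/-! ### Partial sums as cardinal spline series. -/

variable {𝕜 : Type*} [RCLike 𝕜]

lemma hasSum_smul_of_finite {c : ℤ → 𝕜} (hc : (Function.support c).Finite) (g : ℤ → ℝ) :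
    HasSum (fun k => g k • c k) (∑' k, g k • c k) :=
  (summable_of_hasFiniteSupport (hc.subset fun k hk h => hk (by simp [h]))).hasSum

lemma finite_support_comp_two_mul_add {c : ℤ → 𝕜} (hc : (Function.support c).Finite) (p : ℤ) :
    (Function.support fun k => c (2 * k + p)).Finite :=
  hc.preimage (f := fun k : ℤ => 2 * k + p) (fun m _ n _ h => by simpa using h)

/-- One refinement step: cardinal spline interpolation on the half-integers is interpolation on
the integers plus a Faber correction. -/
lemma tsum_L4_two_mul {c : ℤ → 𝕜} (hc : (Function.support c).Finite) (X : ℝ) :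
    ∑' m : ℤ, L4 (2 * X - m) • c m = (∑' k : ℤ, L4 (X - k) • c (2 * k))
      + ∑' k : ℤ, mother (X - k) • ((1 / 6 : ℝ) • (c (2 * k) - (8 : ℝ) • c (2 * k + 1)
        + (23 : ℝ) • c (2 * k + 2) - (32 : ℝ) • c (2 * k + 3) + (23 : ℝ) • c (2 * k + 4)
        - (8 : ℝ) • c (2 * k + 5) + c (2 * k + 6))) := by
  set M : ℤ → 𝕜 := fun p => ∑' k : ℤ, mother (X - k) • c (2 * k + p) with hM
  have hM1 : ∀ p, HasSum (fun k : ℤ => mother (X - k) • c (2 * k + p)) (M p) := fun p =>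
    hasSum_smul_of_finite (finite_support_comp_two_mul_add hc p) _
  have hM2 : ∀ p i : ℤ, HasSum (fun k : ℤ => mother (X - k + i) • c (2 * k + p)) (M (p + 2 * i)) := by
    intro p i
    convert (Equiv.subRight i).hasSum_iff.mpr (hM1 (p + 2 * i)) using 2 with k
    simp only [Function.comp, Equiv.subRight_apply, Int.cast_sub]
    congr 2 <;> ring
  have hA : HasSum (fun k : ℤ => L4 (X - k) • c (2 * k)) (∑' k : ℤ, L4 (X - k) • c (2 * k)) := by
    simpa using hasSum_smul_of_finite (finite_support_comp_two_mul_add hc 0) (fun k => L4 (X - k))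
  have he := hA.add (((((hM2 0 0).add ((hM2 0 1).const_smul (23 : ℝ))).add
    ((hM2 0 2).const_smul (23 : ℝ))).add (hM2 0 3)).const_smul (1 / 6 : ℝ))
  have ho := ((((hM2 1 0).const_smul (8 : ℝ)).add ((hM2 1 1).const_smul (32 : ℝ))).add
    ((hM2 1 2).const_smul (8 : ℝ))).const_smul (-1 / 6 : ℝ)
  have hl := (((((((hM1 0).sub ((hM1 1).const_smul (8 : ℝ))).add ((hM1 2).const_smul (23 : ℝ))).sub
    ((hM1 3).const_smul (32 : ℝ))).add ((hM1 4).const_smul (23 : ℝ))).sub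
    ((hM1 5).const_smul (8 : ℝ))).add (hM1 6)).const_smul (1 / 6 : ℝ)
  -- Shifting `k` by `i` moves `mother (X - k + i)` to `mother (X - k)` and `c (2k + p)` to `c (2k +
  -- p + 2i)`, so all terms become multiples of the sums `M 0, …, M 6`.
  have hL := hasSum_int_even_add_odd (f := fun m : ℤ => L4 (2 * X - m) • c m)
    (he.congr_fun fun k => ?_) (ho.congr_fun fun k => ?_)
  · rw [hL.tsum_eq, add_assoc]
    congr 1
    rw [(hl.congr_fun fun k => ?_).tsum_eq]
    · norm_num only
      module
    · simp only [add_zero]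
      module
  · have h := L4_two_mul (X - k)
    rw [mul_sub] at h
    simp only [Int.cast_mul, Int.cast_ofNat, h, Int.cast_zero, Int.cast_one, add_zero]
    module
  · have h := L4_two_mul_sub_one (X - k)
    rw [mul_sub, sub_sub] at h
    simp only [Int.cast_mul, Int.cast_ofNat, h, Int.cast_zero, Int.cast_one, add_zero, Int.cast_add]
    module

lemma diff_four_dyadic (j : ℕ) (f : ℝ → 𝕜) (p : ℝ) :
    diff 4 (1 / 2 ^ (j + 1)) f (p / 2 ^ (j + 1)) = f (p / 2 ^ (j + 1))
      - (4 : ℝ) • f ((p + 1) / 2 ^ (j + 1)) + (6 : ℝ) • f ((p + 2) / 2 ^ (j + 1))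
      - (4 : ℝ) • f ((p + 3) / 2 ^ (j + 1)) + f ((p + 4) / 2 ^ (j + 1)) := by
  have h : ∀ l : ℝ, p / 2 ^ (j + 1) + 1 / 2 ^ (j + 1) * l = (p + l) / 2 ^ (j + 1) := by
    intro l; ring
  simp only [diff, h, Finset.sum_range_succ, Finset.sum_range_zero]
  norm_num [Nat.choose]
  module

lemma coeff_eq (j : ℕ) (k : ℤ) (f : ℝ → 𝕜) {c : ℤ → 𝕜}
    (hc : ∀ m : ℤ, c m = f (m / 2 ^ (j + 1))) :
    coeff j k f = (1 / 6 : ℝ) • (c (2 * k) - (8 : ℝ) • c (2 * k + 1)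
        + (23 : ℝ) • c (2 * k + 2) - (32 : ℝ) • c (2 * k + 3) + (23 : ℝ) • c (2 * k + 4)
        - (8 : ℝ) • c (2 * k + 5) + c (2 * k + 6)) := by
  simp only [coeff, diff_four_dyadic, hc]
  push_cast
  simp only [add_assoc (2 * (k : ℝ))]
  norm_num only
  module

lemma finite_support_dyadic {f : ℝ → 𝕜} (hfc : HasCompactSupport f) (N : ℕ) :
    (Function.support fun k : ℤ => f (k / 2 ^ N)).Finite := by
  obtain ⟨R, hR⟩ := hfc.isBounded.subset_closedBall (0 : ℝ)
  refine (Set.finite_Icc ⌊-(R * 2 ^ N)⌋ ⌈R * 2 ^ N⌉).subset fun k hk => ?_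
  have h := hR (subset_tsupport f hk)
  rw [mem_closedBall_zero_iff, Real.norm_eq_abs, abs_div, abs_of_pos (a := (2 : ℝ) ^ N) (by positivity),
    div_le_iff₀ (by positivity), abs_le] at h
  constructor
  · have := (Int.floor_le (-(R * 2 ^ N))).trans h.1
    exact_mod_cast this
  · have := h.2.trans (Int.le_ceil (R * 2 ^ N))
    exact_mod_cast this

/-- The partial sums of the Faber spline expansion are cardinal spline interpolants. -/
lemma S_eq_interpolant {f : ℝ → 𝕜} (hfc : HasCompactSupport f) (N : ℕ) (x : ℝ) :
    S N f x = ∑' k : ℤ, L4 (2 ^ N * x - k) • f (k / 2 ^ N) := by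
  induction N with
  | zero => simp [S]
  | succ N ih =>
    have hS : S (N + 1) f x = S N f x + ∑' k : ℤ, s N k x • coeff N k f := by
      simp only [S, Finset.sum_range_succ, add_assoc]
    have h := tsum_L4_two_mul (finite_support_dyadic hfc (N + 1)) (2 ^ N * x)
    rw [hS, ih, pow_succ' 2 N, mul_assoc, ← pow_succ', h]
    congr 1
    · refine tsum_congr fun k => ?_
      congr 2
      push_cast
      rw [pow_succ']
      field_simp
    · refine tsum_congr fun k => ?_
      rw [s_eq, coeff_eq N k f (fun m => rfl)]

/-! ### Uniform convergence. -/

lemma summable_abs_cardCoeff : Summable fun n => |cardCoeff n| := by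
  have hz : |√3 - 2| < 1 := by
    rw [abs_lt]
    have h1 : 1 < √3 := by rw [Real.lt_sqrt] <;> norm_num
    have h2 : √3 < 2 := by rw [Real.sqrt_lt'] <;> norm_num
    constructor <;> linarith
  have h : Summable fun n : ℕ => |cardCoeff n| := by
    simp only [cardCoeff_natCast, abs_mul, abs_pow]
    exact (summable_geometric_of_lt_one (abs_nonneg _) hz).mul_left _
  exact Summable.of_nat_of_neg h (by simpa only [cardCoeff_neg] using h)

/-- Summing the recurrence over `ℤ` gives six times the sum on the left and `6` on the right. -/
lemma hasSum_cardCoeff : HasSum cardCoeff 1 := by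
  have h := summable_abs_cardCoeff.of_abs.hasSum
  have h1 := (Equiv.subRight (1 : ℤ)).hasSum_iff.mpr h
  have h2 := (Equiv.addRight (1 : ℤ)).hasSum_iff.mpr h
  have h3 := (h1.add (h.mul_left 4)).add h2
  have hd : HasSum delta 1 := hasSum_ite_eq 0 1
  have h4 := h3.unique ((hd.mul_left 6).congr_fun fun n => cardCoeff_rec n)
  have h5 : ∑' n, cardCoeff n = 1 := by linarith
  rwa [h5] at h

/-- The interpolant as a B-spline series whose coefficients are convolutions of the data with
`cardCoeff`. -/
lemma hasSum_interpolant {c : ℤ → 𝕜} (hc : (Function.support c).Finite) (X : ℝ) :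
    HasSum (fun m : ℤ => bspline 4 (X + 2 - m) • ∑' k, cardCoeff k • c (m - k))
      (∑' k : ℤ, L4 (X - k) • c k) := by
  have hs : ∀ g : ℤ → ℝ, ∑' k, g k • c k = ∑ k ∈ hc.toFinset, g k • c k := fun g =>
    tsum_eq_sum fun k hk => by
      rw [Set.Finite.mem_toFinset, Function.mem_support, not_not] at hk
      rw [hk, smul_zero]
  rw [hs]
  refine (hasSum_sum (f := fun (k m : ℤ) => (cardCoeff (m - k) * bspline 4 (X + 2 - m)) • c k)
    fun k _ => ?_).congr_fun fun m => ?_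
  · convert ((hasSum_L4_shift (X - k) (-k)).smul_const (c k)) using 5 with m <;> push_cast <;> ring
  · rw [← (Equiv.subLeft m).tsum_eq (fun k => cardCoeff k • c (m - k))]
    simp only [Equiv.subLeft_apply, sub_sub_cancel, hs, Finset.smul_sum]
    refine Finset.sum_congr rfl fun k _ => ?_
    rw [mul_comm, mul_smul]

/-- The modulus `sup_x ‖f(x - t) - f(x)‖` of translation by `t`. -/
def translationModulus (f : ℝ → 𝕜) (t : ℝ) : ℝ := ⨆ x, ‖f (x - t) - f x‖

section Modulus

variable {f : ℝ → 𝕜} {M : ℝ}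

lemma norm_sub_le_two_mul (hM : ∀ x, ‖f x‖ ≤ M) (x y : ℝ) : ‖f x - f y‖ ≤ 2 * M :=
  (norm_sub_le _ _).trans (by linarith [hM x, hM y])

lemma norm_sub_le_translationModulus (hM : ∀ x, ‖f x‖ ≤ M) (t x : ℝ) :
    ‖f (x - t) - f x‖ ≤ translationModulus f t :=
  le_ciSup (f := fun x => ‖f (x - t) - f x‖)
    ⟨2 * M, by rintro _ ⟨y, rfl⟩; exact norm_sub_le_two_mul hM _ _⟩ x

lemma translationModulus_nonneg (t : ℝ) : 0 ≤ translationModulus f t :=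
  Real.iSup_nonneg fun _ => norm_nonneg _

lemma translationModulus_le (hM : ∀ x, ‖f x‖ ≤ M) (t : ℝ) : translationModulus f t ≤ 2 * M :=
  ciSup_le fun _ => norm_sub_le_two_mul hM _ _

lemma tendsto_translationModulus (hf : UniformContinuous f) :
    Tendsto (translationModulus f) (𝓝 0) (𝓝 0) := by
  rw [Metric.tendsto_nhds_nhds]
  intro ε hε
  obtain ⟨δ, hδ, h⟩ := Metric.uniformContinuous_iff.mp hf (ε / 2) (half_pos hε)
  refine ⟨δ, hδ, fun t ht => ?_⟩
  rw [Real.dist_0_eq_abs, abs_of_nonneg (translationModulus_nonneg t)]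
  refine lt_of_le_of_lt (ciSup_le fun x => ?_) (half_lt_self hε)
  rw [← dist_eq_norm]
  refine (h ?_).le
  simpa [Real.dist_eq] using ht

/-- Dominated convergence with majorant `2M |cardCoeff k|`: each fixed shift `k / 2^N` tends to `0`.
-/
lemma tendsto_tsum_translationModulus (hf : UniformContinuous f) (hM : ∀ x, ‖f x‖ ≤ M) :
    Tendsto (fun N : ℕ => ∑' k : ℤ, |cardCoeff k| * translationModulus f (k / 2 ^ N))
      atTop (𝓝 0) := by
  rw [show (0 : ℝ) = ∑' k : ℤ, |cardCoeff k| * 0 by simp]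
  refine tendsto_tsum_of_dominated_convergence (summable_abs_cardCoeff.mul_right (2 * M))
    (fun k => ?_) (Eventually.of_forall fun N k => ?_)
  · refine ((tendsto_translationModulus hf).comp ?_).const_mul _
    exact tendsto_const_nhds.div_atTop (tendsto_pow_atTop_atTop_of_one_lt one_lt_two)
  · rw [Real.norm_of_nonneg (mul_nonneg (abs_nonneg _) (translationModulus_nonneg _))]
    exact mul_le_mul_of_nonneg_left (translationModulus_le hM _) (abs_nonneg _)

/-- As the coefficients sum to `1`, `f(m/2^N)` can be subtracted inside the convolution; the bound
does not depend on `m`. -/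
lemma norm_convolution_sub_le (hM : ∀ x, ‖f x‖ ≤ M) (N : ℕ) (m : ℤ) :
    ‖∑' k : ℤ, cardCoeff k • f ((m - k : ℤ) / 2 ^ N) - f (m / 2 ^ N)‖
      ≤ ∑' k : ℤ, |cardCoeff k| * translationModulus f (k / 2 ^ N) := by
  have hs : Summable fun k : ℤ => cardCoeff k • f ((m - k : ℤ) / 2 ^ N) := by
    refine Summable.of_norm_bounded (summable_abs_cardCoeff.mul_right M) fun k => ?_
    rw [norm_smul, Real.norm_eq_abs]
    exact mul_le_mul_of_nonneg_left (hM _) (abs_nonneg _)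
  have h1 : HasSum (fun k : ℤ => cardCoeff k • f (m / 2 ^ N)) (f (m / 2 ^ N)) := by
    simpa using hasSum_cardCoeff.smul_const (f (m / 2 ^ N))
  have hb : Summable fun k : ℤ => |cardCoeff k| * translationModulus f (k / 2 ^ N) := by
    refine Summable.of_nonneg_of_le
      (fun k => mul_nonneg (abs_nonneg _) (translationModulus_nonneg _)) (fun k => ?_)
      (summable_abs_cardCoeff.mul_right (2 * M))
    exact mul_le_mul_of_nonneg_left (translationModulus_le hM _) (abs_nonneg _)
  rw [← (hs.hasSum.sub h1).tsum_eq]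
  refine tsum_of_norm_bounded hb.hasSum fun k => ?_
  rw [← smul_sub, norm_smul, Real.norm_eq_abs]
  refine mul_le_mul_of_nonneg_left ?_ (abs_nonneg _)
  rw [Int.cast_sub, sub_div]
  exact norm_sub_le_translationModulus hM _ _

end Modulus

/-- The uniform error of dyadic spline interpolation, in terms of moduli of continuity. -/
lemma norm_S_sub_le {f : ℝ → 𝕜} (hfc : HasCompactSupport f) {M : ℝ} (hM : ∀ x, ‖f x‖ ≤ M) {N : ℕ}
    {ε : ℝ} (hε : ∀ x y : ℝ, |x - y| ≤ 2 / 2 ^ N → ‖f x - f y‖ ≤ ε) (x : ℝ) :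
    ‖S N f x - f x‖
      ≤ (∑' k : ℤ, |cardCoeff k| * translationModulus f (k / 2 ^ N)) + ε := by
  set D := ∑' k : ℤ, |cardCoeff k| * translationModulus f (k / 2 ^ N) with hD
  set X : ℝ := 2 ^ N * x with hX
  have hB : HasSum (fun m : ℤ => bspline 4 (X + 2 - m)) 1 := by
    rw [← tsum_bspline_four (X + 2)]
    exact (summable_of_hasFiniteSupport (finite_support_bspline_four _)).hasSum
  have h1 := hasSum_interpolant (finite_support_dyadic hfc N) X
  rw [← S_eq_interpolant hfc] at h1
  have h2 := hB.smul_const (f x)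
  rw [one_smul] at h2
  have h3 := hB.mul_right (D + ε)
  rw [one_mul] at h3
  rw [← (h1.sub h2).tsum_eq]
  refine tsum_of_norm_bounded h3 fun m => ?_
  rw [← smul_sub, norm_smul, Real.norm_of_nonneg (bspline_nonneg _ _)]
  -- Only `m` with `|m - X| < 2` contribute, whence the radius `2 / 2^N` in `hε`.
  by_cases hm : X + 2 - m ≤ 0 ∨ 4 ≤ X + 2 - m
  · simp [bspline_four_eq_zero hm]
  · rw [not_or, not_le, not_le] at hm
    refine mul_le_mul_of_nonneg_left ?_ (bspline_nonneg _ _)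
    refine (norm_sub_le_norm_sub_add_norm_sub _ (f (m / 2 ^ N)) _).trans ?_
    refine add_le_add (norm_convolution_sub_le hM N m) (hε _ _ ?_)
    have hp : (0 : ℝ) < 2 ^ N := by positivity
    have : (m : ℝ) / 2 ^ N - x = (m - X) / 2 ^ N := by rw [hX]; field_simp
    rw [this, abs_div, abs_of_pos hp, div_le_div_iff_of_pos_right hp, abs_le]
    constructor <;> linarith [hm.1, hm.2]

end FaberSpline

end

theorem theorem3p5 {𝕜 : Type*} [RCLike 𝕜] (f : ℝ → 𝕜) (hf : Continuous f)
    (hfc : HasCompactSupport f) :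
    TendstoUniformly (fun N : ℕ => FaberSpline.S N f) f Filter.atTop := by
  obtain ⟨M, hM⟩ := hfc.exists_bound_of_continuous hf
  have huc : UniformContinuous f := hfc.uniformContinuous_of_continuous hf
  rw [Metric.tendstoUniformly_iff]
  intro ε hε
  obtain ⟨δ, hδ, h⟩ := Metric.uniformContinuous_iff.mp huc (ε / 2) (half_pos hε)
  have h1 := (FaberSpline.tendsto_tsum_translationModulus huc hM).eventually
    (gt_mem_nhds (half_pos hε))
  have h2 : ∀ᶠ N : ℕ in Filter.atTop, (2 : ℝ) / 2 ^ N < δ :=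
    ((tendsto_const_nhds (x := (2 : ℝ))).div_atTop
      (tendsto_pow_atTop_atTop_of_one_lt one_lt_two)).eventually (gt_mem_nhds hδ)
  filter_upwards [h1, h2] with N hN1 hN2 x
  rw [dist_comm, dist_eq_norm]
  refine (FaberSpline.norm_S_sub_le hfc hM (N := N) (ε := ε / 2) (fun a b hab => ?_) x).trans_lt
    (by linarith)
  rw [← dist_eq_norm]
  exact (h (lt_of_le_of_lt (by rwa [Real.dist_eq]) hN2)).le
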